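/- Consider a finite set $N$ of $n$ jobs with weights $w_j\ge 0$, processing times $p_j\ge 0$ and precedence constraints $A\subset N\times N$ such that $(N,A)$ is a directed acyclic graph, and $m\ge 1$ identical parallel machines. A job is available if it is not completed but all its predecessors are. A (preemptive) schedule assigns to each available job $j$ a processing rate $R_j(t)\in[0,1]$ at every time $t\ge 0$ such that $\sum_j R_j(t)\le m$ (unavailable jobs have rate $0$). The elapsed processing time of $j$ is $Y_j(t)=\int_0^t R_j(s)\,\mathrm ds$, and its completion time $C_j$ is the first time $t$ at which $Y_j(t)\ge p_j$ and all predecessors of $j$ are completed; every job has to be completed at a finite time. The objective is to minimize the total weighted completion time $\sum_{j} w_jC_j$. A non-clairvoyant algorithm knows $m$, the weights and the precedence constraints, but learns the processing times only when the jobs are completed. Let $U_t$ be the set of jobs that are unfinished at time $t$ ($C_j>t$) and $F_t\subseteq U_t$ the set of available jobs at time $t$. Let $D_t$ be the network with nodes $U_t\cup\{\mathrm A,\mathrm B,\mathrm Z\}$ and, for $\pi>0$, the following arcs and capacities: $(\mathrm A,\mathrm B)$ with capacity $m$; $(\mathrm B,j)$ with capacity $1$ for $j\in F_t$; $(j,k)$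 with capacity $\infty$ for $j,k\in U_t$ with $(j,k)\in A$; and $(j,\mathrm Z)$ with capacity $w_j/\pi$ for $j\in U_t$. The algorithm computes rates at time $t$ as follows. If $|F_t|\le m$, then $R_j(t)=1$ for all $j\in F_t$. Otherwise let $\pi_t$ be the largest $\pi>0$ for which $\{\mathrm A\}$ is (the source side of) a minimum-capacity $\mathrm A$-$\mathrm Z$-cut, let $x^t$ be an arbitrary maximum $\mathrm A$-$\mathrm Z$-flow for the capacities with $\pi=\pi_t$, and set $R_j(t)=x^t_{(\mathrm B,j)}$ for all $j\in F_t$. The rates are computed at time $0$ and at every job completion time after which unfinished jobs remain, and they are kept constant in between. **Theorem.** This is a $3$-competitive strategy for total weighted completion time minimization. In detail: 1. If all weights are positive, then the computation of the rates is well-defined for every set of unfinished jobs (that is, $\pi_t$ and $x^t$ exist). 2. For every rule that selects, for each set of unfinished jobs that is non-empty and closed under successors, one of the possible results of the rate computation (such a rule does not depend on the processing times), and for all processing times $p_j\ge 0$, following this rule yields a schedule in which every job is completed. 3. For all weights $w_j\ge 0$ and processing times $p_j\ge 0$, every schedule with completion times $C_j$ that can result from the algorithm, with whatever choices of the maximum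 flows, and every feasible schedule with completion times $C_j'$ satisfy $$\sum_{j\in N} w_jC_j\le 3\sum_{j\in N} w_jC_j'.$$ In particular, the algorithm's cost is at most three times the optimum with full information. -/

import Mathlib

open MeasureTheory

noncomputable section

namespace PrecSched

/-! ## Capacitated networks on a finite vertex type

A network is given by its capacity function `u : V → V → ℝ≥0∞`. A pair that is not an arc has
capacity `0`, so that it carries no flow and does not contribute to the capacity of a cut. -/

section Network

variable {V : Type*} [Fintype V]

/-- `x` is an `s`-`z`-flow for the capacities `u`. -/
structure IsFlow (u : V → V → ENNReal) (s z : V) (x : V → V → ℝ) : Prop where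
  nonneg : ∀ a b, 0 ≤ x a b
  le_cap : ∀ a b, ENNReal.ofReal (x a b) ≤ u a b
  conserve : ∀ v, v ≠ s → v ≠ z → ∑ a, x a v = ∑ b, x v b

/-- The value of a flow with source `s`: the net flow out of `s`. -/
def flowValue (s : V) (x : V → V → ℝ) : ℝ := ∑ b, x s b - ∑ a, x a s

/-- `x` is an `s`-`z`-flow of maximum value. -/
def IsMaxFlow (u : V → V → ENNReal) (s z : V) (x : V → V → ℝ) : Prop :=
  IsFlow u s z x ∧ ∀ y, IsFlow u s z y → flowValue s y ≤ flowValue s x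

open Classical in
/-- The capacity of the cut `(S, V \ S)`. -/
def cutCapacity (u : V → V → ENNReal) (S : Set V) : ENNReal :=
  ∑ a, ∑ b, if a ∈ S ∧ b ∉ S then u a b else 0

/-- `(S, V \ S)` is an `s`-`z`-cut of minimum capacity. -/
def IsMinCut (u : V → V → ENNReal) (s z : V) (S : Set V) : Prop :=
  s ∈ S ∧ z ∉ S ∧ ∀ T : Set V, s ∈ T → z ∉ T → cutCapacity u S ≤ cutCapacity u T

end Network

/-- The nodes of the flow network: one node for each job and three additional nodes. -/
inductive Node (ι : Type*) where
  | A : Node ι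
  | B : Node ι
  | Z : Node ι
  | job : ι → Node ι
  deriving Fintype

/-! ## The scheduling problem -/

/-- What a non-clairvoyant scheduler knows from the beginning: the number `m ≥ 1` of machines, the
weights `w j ≥ 0`, and the arcs `prec` of the precedence graph, which is acyclic. The processing
times are not part of it. -/
structure KnownData (ι : Type*) where
  m : ℕ
  m_pos : 0 < m
  w : ι → ℝ
  w_nonneg : ∀ j, 0 ≤ w j
  prec : ι → ι → Prop
  acyclic : ∀ j, ¬ Relation.TransGen prec j j

variable {ι : Type*} [Fintype ι]

open Classical in
/-- The jobs that are unfinished at time `t` when the completion times are `C`. -/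
def unfinished (C : ι → ℝ) (t : ℝ) : Finset ι := {j | t < C j}

/-- The amount of processing that a job with processing rate `r` has received up to time `t`. -/
def elapsed (r : ℝ → ℝ) (t : ℝ) : ℝ := ∫ s in (0 : ℝ)..t, r s

namespace KnownData

variable (D : KnownData ι)

open Classical in
/-- The available jobs when `U` is the set of unfinished jobs: the jobs of `U` all of whose
predecessors are finished. -/
def available (U : Finset ι) : Finset ι := {j ∈ U | ∀ k, D.prec k j → k ∉ U}

/-- `U` contains with a job also all its successors. -/
def SuccClosed (U : Finset ι) : Prop := ∀ j k, D.prec j k → j ∈ U → k ∈ U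

/-- Feasible preemptive schedules for the processing times `p`: `R j t` is the processing rate of
job `j` at time `t ≥ 0`, and `C j` is its completion time, i.e. the first time at which its elapsed
processing time has reached `p j` and its predecessors are completed. (The latter is automatic if
`0 < p j`, as only available jobs are processed; a job with `p j = 0` has to wait for its
predecessors, too.) -/
structure IsSchedule (p : ι → ℝ) (R : ι → ℝ → ℝ) (C : ι → ℝ) : Prop where
  integrable : ∀ j, ∀ t, 0 ≤ t → IntervalIntegrable (R j) volume 0 t
  rate_nonneg : ∀ j, ∀ t, 0 ≤ t → 0 ≤ R j t
  rate_le_one : ∀ j, ∀ t, 0 ≤ t → R j t ≤ 1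
  sum_rate_le : ∀ t, 0 ≤ t → ∑ j, R j t ≤ D.m
  rate_eq_zero : ∀ j, ∀ t, 0 ≤ t → j ∉ D.available (unfinished C t) → R j t = 0
  completion : ∀ j,
    IsLeast {t | 0 ≤ t ∧ (∀ k, D.prec k j → C k ≤ t) ∧ p j ≤ elapsed (R j) t} (C j)

/-- The total weighted completion time. -/
def cost (C : ι → ℝ) : ℝ := ∑ j, D.w j * C j

/-! ## The algorithm -/

open Classical in
/-- The capacities of the network for the set `U` of unfinished jobs and the parameter `π`. The
nodes of finished jobs are isolated. -/
def netCap (U : Finset ι) (π : ℝ) : Node ι → Node ι → ENNReal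
  | .A, .B => D.m
  | .B, .job j => if j ∈ D.available U then 1 else 0
  | .job j, .job k => if j ∈ U ∧ k ∈ U ∧ D.prec j k then ⊤ else 0
  | .job j, .Z => if j ∈ U then ENNReal.ofReal (D.w j / π) else 0
  | _, _ => 0

/-- `r` is a possible result of the rate computation when `U` is the set of unfinished jobs: if
there are at most `m` available jobs, they all get rate `1`; otherwise the rates are the flows on
the arcs out of `B` in some maximum flow for the parameter `π`, where `π` is the largest positive
number for which `{A}` is a minimum cut. Only the rates of available jobs matter. -/
def IsRateChoice (U : Finset ι) (r : ι → ℝ) : Prop :=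
  ((D.available U).card ≤ D.m ∧ ∀ j ∈ D.available U, r j = 1) ∨
  (D.m < (D.available U).card ∧
    ∃ π : ℝ, IsGreatest {π | 0 < π ∧ IsMinCut (D.netCap U π) Node.A Node.Z {Node.A}} π ∧
      ∃ x : Node ι → Node ι → ℝ, IsMaxFlow (D.netCap U π) Node.A Node.Z x ∧
        ∀ j ∈ D.available U, r j = x Node.B (Node.job j))

/-- `(R, C)` is a schedule that results, for the processing times `p`, from computing rates by
the algorithm at time `0` and at the completion times of jobs, and from keeping them fixed as long
as no further job is completed. Different maximum flows may be chosen at different times. -/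
structure IsRun (p : ι → ℝ) (R : ι → ℝ → ℝ) (C : ι → ℝ) : Prop where
  isSchedule : D.IsSchedule p R C
  rates : ∀ t, 0 ≤ t → (unfinished C t).Nonempty →
    D.IsRateChoice (unfinished C t) (fun j => R j t)
  const : ∀ s t, 0 ≤ s → s ≤ t → unfinished C s = unfinished C t → ∀ j, R j s = R j t

end KnownData

end PrecSched

end

/-! The cost of a run is the integral over time of the weight of the unfinished jobs. At each time
this weight is split by a set `T`, and the two parts are charged once and twice to the cost of an
arbitrary schedule `C'`.

If more than `m` jobs are available, the chosen flow has value `m`, because `{A}` is a minimum cut.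
By maximality of `π` another cut, with source side `A`, `B` and a successor-closed set `T` of
unfinished jobs, is tight as well (`exists_tight`). The flow saturates both cuts: available jobs
outside `T` run at rate 1, and each `k ∈ T` sends exactly `w k / π` to the sink
(`FlowFacts.saturated`). With at most `m` available jobs, `T = ∅` does. `IsServed` records what is
needed.

Outside `T`: the unfinished ancestors of an unfinished job outside `T` are outside `T` too, so the
available ones run at full speed. Hence the time that `k` spends outside `T` is at most the length
of a chain ending at `k`, and so at most `C' k` (`integral_notMem_le`).

Inside `T`: let `y k` be the flow from `k` to the sink, at most `w k / π`, and `q k` its integral.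
Flow only runs from jobs to successors, so `q` is at most `p` in total on each predecessor-closed
set. Therefore `C'` also completes the sizes `q` on one machine of speed `m`, and mutual delays
bound the sum of `min (w k * q l) (w l * q k)` by `2 m` times its cost (`sum_min_le`). At each time
this sum with `y` for `q` is at least `m` times the weight of `T`; integrating gives the factor 2
(`integral_weight_le`). -/

noncomputable section

namespace PrecSched

/-! ### Max-flow min-cut -/

section MaxFlow

variable {V : Type*} [Fintype V]

/-- The net flow out of a vertex. -/
def netOut (x : V → V → ℝ) (v : V) : ℝ := ∑ b, x v b - ∑ a, x a v

lemma netOut_combination (x y : V → V → ℝ) (r : ℝ) (v : V) :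
    netOut (fun a b => (1 - r) * x a b + r * y a b) v = (1 - r) * netOut x v + r * netOut y v := by
  simp only [netOut, Finset.sum_add_distrib, ← Finset.mul_sum]
  ring

open Classical in
lemma netOut_add_arc (x : V → V → ℝ) (a b : V) (d : ℝ) (v : V) :
    netOut (fun i j => x i j + if i = a ∧ j = b then d else 0) v =
      netOut x v + (if v = a then d else 0) - (if v = b then d else 0) := by
  have h1 : ∑ j, (if v = a ∧ j = b then d else 0) = if v = a then d else 0 := by
    by_cases h : v = a <;> simp [h]
  have h2 : ∑ i, (if i = a ∧ v = b then d else 0) = if v = b then d else 0 := by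
    by_cases h : v = b <;> simp [h]
  simp only [netOut, Finset.sum_add_distrib, h1, h2]
  ring

open Classical in
lemma sum_netOut (x : V → V → ℝ) (S : Finset V) :
    ∑ v ∈ S, netOut x v = ∑ a ∈ S, ∑ b ∈ Sᶜ, (x a b - x b a) := by
  have h : ∀ f : V → ℝ, ∑ b, f b = ∑ b ∈ S, f b + ∑ b ∈ Sᶜ, f b := fun f =>
    (Finset.sum_add_sum_compl S f).symm
  simp only [netOut, h, Finset.sum_sub_distrib, Finset.sum_add_distrib]
  rw [Finset.sum_comm (s := S) (t := S)]
  ring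

open Classical in
/-- Along a residual path some flow can be sent, keeping the capacities. -/
lemma exists_augmentation {c x : V → V → ℝ} (hx0 : ∀ a b, 0 ≤ x a b) (hxc : ∀ a b, x a b ≤ c a b)
    {s v : V} (h : Relation.ReflTransGen (fun a b => x a b < c a b ∨ 0 < x b a) s v) :
    ∃ (y : V → V → ℝ) (e : ℝ), 0 < e ∧ (∀ a b, 0 ≤ y a b) ∧ (∀ a b, y a b ≤ c a b) ∧
      ∀ u, netOut y u = netOut x u + (if u = s then e else 0) - (if u = v then e else 0) := by
  induction h with
  | refl => exact ⟨x, 1, one_pos, hx0, hxc, fun u => by ring⟩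
  | @tail a b _ hab ih =>
    obtain ⟨y, e, he, hy0, hyc, hy⟩ := ih
    obtain ⟨g, hg, hgab⟩ : ∃ g : ℝ, 0 < g ∧ (g ≤ c a b - x a b ∨ g ≤ x b a) := by
      rcases hab with h | h
      · exact ⟨c a b - x a b, by linarith, Or.inl le_rfl⟩
      · exact ⟨x b a, h, Or.inr le_rfl⟩
    -- In the convex combination of `x` and `y` the last arc keeps residual capacity at least `(1 -
    -- r) * g ≥ g / 2`, which suffices for the amount `r * e` arriving at `a`.
    set r : ℝ := min (1 / 2) (g / (2 * e)) with hr
    have hr0 : 0 < r := by positivity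
    have hr2 : r ≤ 1 / 2 := min_le_left _ _
    have hre : r * e ≤ g / 2 := by
      calc r * e ≤ g / (2 * e) * e := by gcongr; exact min_le_right _ _
        _ = g / 2 := by field_simp
    have hre0 : 0 < r * e := by positivity
    have hz0 : ∀ i j, 0 ≤ (1 - r) * x i j + r * y i j := fun i j =>
      add_nonneg (mul_nonneg (by linarith) (hx0 i j)) (mul_nonneg hr0.le (hy0 i j))
    have hzc : ∀ i j, (1 - r) * x i j + r * y i j ≤ c i j := fun i j => by
      have := mul_le_mul_of_nonneg_left (hxc i j) (by linarith : (0 : ℝ) ≤ 1 - r)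
      have := mul_le_mul_of_nonneg_left (hyc i j) hr0.le
      linarith
    rcases hgab with hgab | hgab
    · refine ⟨fun i j => (1 - r) * x i j + r * y i j + if i = a ∧ j = b then r * e else 0, r * e,
        hre0, fun i j => ?_, fun i j => ?_, fun u => ?_⟩
      · have := hz0 i j
        beta_reduce
        split_ifs <;> linarith
      · beta_reduce
        split_ifs with hij
        · obtain ⟨rfl, rfl⟩ := hij
          have h1 := mul_le_mul_of_nonneg_left (hyc i j) hr0.le
          have h2 := mul_le_mul_of_nonneg_left hgab (by linarith : (0 : ℝ) ≤ 1 - r)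
          nlinarith
        · simpa using hzc i j
      · rw [netOut_add_arc, netOut_combination, hy]
        split_ifs <;> ring
    · refine ⟨fun i j => (1 - r) * x i j + r * y i j + if i = b ∧ j = a then -(r * e) else 0, r * e,
        hre0, fun i j => ?_, fun i j => ?_, fun u => ?_⟩
      · beta_reduce
        split_ifs with hij
        · obtain ⟨rfl, rfl⟩ := hij
          have h1 := mul_nonneg hr0.le (hy0 i j)
          have h2 := mul_le_mul_of_nonneg_left hgab (by linarith : (0 : ℝ) ≤ 1 - r)
          nlinarith
        · simpa using hz0 i j
      · have := hzc i j
        beta_reduce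
        split_ifs <;> linarith
      · rw [netOut_add_arc, netOut_combination, hy]
        split_ifs <;> ring

open Classical in
/-- Max-flow min-cut for finite capacities. -/
theorem exists_flow_eq_cut {c : V → V → ℝ} (hc : ∀ a b, 0 ≤ c a b) {s z : V} (hsz : s ≠ z) :
    ∃ x, IsFlow (fun a b => ENNReal.ofReal (c a b)) s z x ∧ ∃ S : Finset V, s ∈ S ∧ z ∉ S ∧
      flowValue s x = ∑ a ∈ S, ∑ b ∈ Sᶜ, c a b := by
  have hcont : ∀ v, Continuous fun x : V → V → ℝ => netOut x v := fun v => by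
    unfold netOut; fun_prop
  have hK : IsCompact (Set.Icc (0 : V → V → ℝ) c ∩ {x | ∀ v, v ≠ s → v ≠ z → netOut x v = 0}) := by
    refine isCompact_Icc.inter_right ?_
    simp only [Set.ofPred_forall]
    exact isClosed_iInter fun v => isClosed_iInter fun _ => isClosed_iInter fun _ =>
      isClosed_eq (hcont v) continuous_const
  obtain ⟨x, ⟨⟨hx0, hxc⟩, hx⟩, hmax⟩ := hK.exists_isMaxOn
    ⟨0, ⟨le_rfl, fun a b => hc a b⟩, fun v _ _ => by simp [netOut]⟩ (hcont s).continuousOn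
  -- The cut consists of the vertices reachable in the residual graph of a maximum flow: reaching
  -- `z` would contradict maximality, and no residual arc leaves `S`.
  set S : Finset V :=
    {v | Relation.ReflTransGen (fun a b => x a b < c a b ∨ 0 < x b a) s v} with hS
  have hsS : s ∈ S := by simp [hS, Relation.ReflTransGen.refl]
  have hzS : z ∉ S := fun hz => by
    obtain ⟨y, e, he, hy0, hyc, hy⟩ :=
      exists_augmentation hx0 hxc (by simpa [hS] using hz)
    have := hmax (a := y) ⟨⟨hy0, hyc⟩, fun v hvs hvz => by rw [hy, hx v hvs hvz]; simp [hvs, hvz]⟩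
    simp only [Set.mem_ofPred_eq, hy, if_pos, if_neg hsz] at this
    linarith
  refine ⟨x, ⟨hx0, fun a b => ENNReal.ofReal_le_ofReal (hxc a b), fun v hvs hvz => ?_⟩, S, hsS, hzS,
    ?_⟩
  · have := hx v hvs hvz
    unfold netOut at this
    linarith
  · have h1 : flowValue s x = ∑ v ∈ S, netOut x v := by
      rw [Finset.sum_eq_single_of_mem s hsS fun v hv hvs => hx v hvs fun h => hzS (h ▸ hv)]
      rfl
    rw [h1, sum_netOut]
    refine Finset.sum_congr rfl fun a ha => Finset.sum_congr rfl fun b hb => ?_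
    have hnot : ¬ (x a b < c a b ∨ 0 < x b a) := fun h => by
      simp only [hS, Finset.mem_compl, Finset.mem_filter_univ] at ha hb
      exact hb (ha.tail h)
    push Not at hnot
    have h1 := hxc a b
    have h2 := hx0 b a
    simp only [Pi.zero_apply] at h2
    linarith [hnot.1, hnot.2]

open Classical in
lemma cutCapacity_coe (u : V → V → ENNReal) (S : Finset V) :
    cutCapacity u S = ∑ a ∈ S, ∑ b ∈ Sᶜ, u a b := by
  rw [cutCapacity, ← Finset.sum_filter_add_sum_filter_not Finset.univ (· ∈ S)]
  simp only [Finset.filter_mem_eq_inter, Finset.univ_inter, Finset.mem_coe]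
  rw [Finset.sum_eq_zero (s := Finset.univ.filter _), add_zero]
  · refine Finset.sum_congr rfl fun a ha => ?_
    rw [← Finset.sum_filter]
    exact Finset.sum_congr (by ext b; simp [ha]) fun _ _ => rfl
  · intro a ha
    simp [(Finset.mem_filter.1 ha).2]

open Classical in
/-- If every cut has capacity at least `M`, then there is a flow of value at least `M`, also in the
presence of infinite capacities. -/
theorem exists_flow_of_le_cutCapacity {u : V → V → ENNReal} {s z : V} (hsz : s ≠ z) {M : ℝ}
    (h : ∀ S : Set V, s ∈ S → z ∉ S → ENNReal.ofReal M ≤ cutCapacity u S) :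
    ∃ x, IsFlow u s z x ∧ M ≤ flowValue s x := by
  -- Capacities are truncated at `M`. If the value stayed below `M`, no arc across the resulting cut
  -- could be truncated, as it alone would contribute `M`; so the cut would have capacity below `M`
  -- for `u` as well.
  have hfin : ∀ a b, min (u a b) (ENNReal.ofReal M) ≠ ⊤ := fun a b =>
    ne_top_of_le_ne_top ENNReal.ofReal_ne_top (min_le_right _ _)
  obtain ⟨x, hx, S, hs, hz, hval⟩ := exists_flow_eq_cut (s := s) (z := z)
    (c := fun a b => (min (u a b) (ENNReal.ofReal M)).toReal) (fun _ _ => ENNReal.toReal_nonneg) hsz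
  refine ⟨x, ⟨hx.nonneg, fun a b => (hx.le_cap a b).trans ?_, hx.conserve⟩, ?_⟩
  · rw [ENNReal.ofReal_toReal (hfin a b)]
    exact min_le_left _ _
  · have hcut := h S (by simpa using hs) (by simpa using hz)
    have hv : ENNReal.ofReal (flowValue s x) =
        ∑ a ∈ S, ∑ b ∈ Sᶜ, min (u a b) (ENNReal.ofReal M) := by
      rw [hval, ENNReal.ofReal_sum_of_nonneg
        fun _ _ => Finset.sum_nonneg fun _ _ => ENNReal.toReal_nonneg]
      refine Finset.sum_congr rfl fun a _ => ?_
      rw [ENNReal.ofReal_sum_of_nonneg fun _ _ => ENNReal.toReal_nonneg]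
      exact Finset.sum_congr rfl fun b _ => ENNReal.ofReal_toReal (hfin a b)
    by_contra! hlt
    have hlt' : ENNReal.ofReal (flowValue s x) < ENNReal.ofReal M :=
      (ENNReal.ofReal_lt_ofReal_iff_of_nonneg (by rw [hval]; positivity)).2 hlt
    rw [cutCapacity_coe] at hcut
    refine absurd hlt' (not_lt.2 (hcut.trans (le_of_eq ?_)))
    rw [hv]
    refine Finset.sum_congr rfl fun a ha => Finset.sum_congr rfl fun b hb => ?_
    refine (min_eq_left ?_).symm
    by_contra! hgt
    refine absurd hlt' (not_lt.2 ?_)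
    rw [hv]
    calc ENNReal.ofReal M = min (u a b) (ENNReal.ofReal M) := (min_eq_right hgt.le).symm
      _ ≤ ∑ b ∈ Sᶜ, min (u a b) (ENNReal.ofReal M) :=
        Finset.single_le_sum (f := fun b => min (u a b) (ENNReal.ofReal M)) (fun _ _ => zero_le) hb
      _ ≤ _ := Finset.single_le_sum
        (f := fun a => ∑ b ∈ Sᶜ, min (u a b) (ENNReal.ofReal M)) (fun _ _ => zero_le) ha

end MaxFlow

/-! ### Cuts of the job network and the critical parameter -/

section

variable {ι : Type*} [Fintype ι]

lemma Node.sum_eq {M : Type*} [AddCommMonoid M] (f : Node ι → M) :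
    ∑ v, f v = f .A + (f .B + (f .Z + ∑ j, f (.job j))) := by
  let e : Option (Option (Option ι)) ≃ Node ι :=
    { toFun := fun o => match o with
        | none => .A
        | some none => .B
        | some (some none) => .Z
        | some (some (some j)) => .job j
      invFun := fun v => match v with
        | .A => none
        | .B => some none
        | .Z => some (some none)
        | .job j => some (some (some j))
      left_inv := by rintro (_ | _ | _ | j) <;> rfl
      right_inv := by rintro (_ | _ | _ | j) <;> rfl }
  rw [← e.sum_comp, Fintype.sum_option, Fintype.sum_option, Fintype.sum_option]
  rfl

namespace KnownData

variable (D : KnownData ι) {U T : Finset ι} {π : ℝ}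

/-- `T` is a subset of `U` that is closed under successors within `U`. -/
def ClosedIn (U T : Finset ι) : Prop := T ⊆ U ∧ ∀ j k, D.prec j k → j ∈ T → k ∈ U → k ∈ T

open Classical in
/-- The capacity of the cut with source side `A`, `B`, `T`, for `T` closed under successors. -/
def jobCut (U : Finset ι) (π : ℝ) (T : Finset ι) : ℝ :=
  (D.available U \ T).card + (∑ j ∈ T, D.w j) / π

lemma mem_available {j : ι} : j ∈ D.available U ↔ j ∈ U ∧ ∀ k, D.prec k j → k ∉ U := by
  simp [available]

lemma available_subset : D.available U ⊆ U := fun _ hj => (D.mem_available.1 hj).1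

lemma cutCapacity_singleton : cutCapacity (D.netCap U π) {Node.A} = D.m := by
  simp [cutCapacity, Node.sum_eq, netCap]

-- No infinite arc leaves a successor-closed set. The nodes of finished jobs are isolated, so they
-- may lie on either side.
open Classical in
lemma cutCapacity_of_closedIn {S : Set (Node ι)} (hA : Node.A ∈ S) (hB : Node.B ∈ S)
    (hZ : Node.Z ∉ S) (hT : D.ClosedIn U T) (hST : ∀ j ∈ U, Node.job j ∈ S ↔ j ∈ T) (hπ : 0 < π) :
    cutCapacity (D.netCap U π) S = ENNReal.ofReal (D.jobCut U π T) := by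
  have h1 : ∑ j, (if Node.job j ∉ S then (if j ∈ D.available U then (1 : ENNReal) else 0) else 0) =
      ENNReal.ofReal ((D.available U \ T).card : ℝ) := by
    rw [ENNReal.ofReal_natCast, Finset.card_eq_sum_ones, Nat.cast_sum, Finset.sum_ite,
      Finset.sum_const_zero, add_zero, Finset.sum_ite, Finset.sum_const_zero, add_zero]
    refine Finset.sum_congr ?_ fun _ _ => by simp
    ext j
    simp only [Finset.mem_filter, Finset.mem_univ, true_and, Finset.mem_sdiff]
    constructor
    · rintro ⟨h, h'⟩
      exact ⟨h', fun hj => h ((hST j (hT.1 hj)).2 hj)⟩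
    · rintro ⟨h, h'⟩
      exact ⟨fun hj => h' ((hST j (D.available_subset h)).1 hj), h⟩
  have h2 : ∑ j, (if Node.job j ∈ S then (if j ∈ U then ENNReal.ofReal (D.w j / π) else 0) else 0) =
      ENNReal.ofReal ((∑ j ∈ T, D.w j) / π) := by
    rw [Finset.sum_div, ENNReal.ofReal_sum_of_nonneg
      fun j _ => div_nonneg (D.w_nonneg j) hπ.le, Finset.sum_ite,
      Finset.sum_const_zero, add_zero, Finset.sum_ite, Finset.sum_const_zero, add_zero]
    refine Finset.sum_congr ?_ fun _ _ => rfl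
    ext j
    simp only [Finset.mem_filter, Finset.mem_univ, true_and]
    exact ⟨fun h => (hST j h.2).1 h.1, fun h => ⟨(hST j (hT.1 h)).2 h, hT.1 h⟩⟩
  have h3 : ∀ j k, (if Node.job j ∈ S ∧ Node.job k ∉ S then
      (if j ∈ U ∧ k ∈ U ∧ D.prec j k then (⊤ : ENNReal) else 0) else 0) = 0 := by
    intro j k
    split_ifs with h h'
    · exact absurd ((hST k h'.2.1).2 (hT.2 j k h'.2.2 ((hST j h'.1).1 h.1) h'.2.1)) h.2
    · rfl
    · rfl
  rw [jobCut, ENNReal.ofReal_add (by positivity)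
    (div_nonneg (Finset.sum_nonneg fun j _ => D.w_nonneg j) hπ.le), ← h1, ← h2, cutCapacity]
  simp only [Node.sum_eq, netCap, hA, hB, hZ, h3, not_true, and_false, if_false, true_and,
    zero_add, not_false_eq_true, and_true, Finset.sum_const_zero, add_zero, false_and, ite_self]

/-- A source side without `B` already pays `m` for the arc from `A`, and one with `B` whose
unfinished jobs are not successor-closed is crossed by an infinite arc. Only the cuts of `jobCut`
can be cheaper than `m`. -/
lemma isMinCut_singleton_iff (hπ : 0 < π) :
    IsMinCut (D.netCap U π) Node.A Node.Z {Node.A} ↔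
      ∀ T, D.ClosedIn U T → (D.m : ℝ) ≤ D.jobCut U π T := by
  classical
  have hm : (D.m : ENNReal) = ENNReal.ofReal (D.m : ℝ) := (ENNReal.ofReal_natCast _).symm
  have hm0 : (0 : ℝ) < D.m := by exact_mod_cast D.m_pos
  simp only [IsMinCut, Set.mem_singleton_iff, reduceCtorEq, not_false_eq_true, true_and,
    cutCapacity_singleton]
  constructor
  · intro h T hT
    have := h ({v | v = .A ∨ v = .B ∨ ∃ j ∈ T, v = .job j}) (by simp) (by simp)
    rw [D.cutCapacity_of_closedIn (by simp) (by simp) (by simp) hT (by simp) hπ, hm,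
      ENNReal.ofReal_le_ofReal_iff'] at this
    exact this.resolve_right (not_le.2 hm0)
  · intro h S hA hZ
    by_cases hB : Node.B ∈ S
    · by_cases hcl : D.ClosedIn U {j ∈ U | Node.job j ∈ S}
      · rw [D.cutCapacity_of_closedIn hA hB hZ hcl (fun j hj => by simp [hj]) hπ, hm]
        exact ENNReal.ofReal_le_ofReal (h _ hcl)
      · simp only [ClosedIn, Finset.filter_subset, true_and, not_forall, Finset.mem_filter] at hcl
        obtain ⟨j, k, hjk, hj, hk, hkS⟩ := hcl
        have hkS' : Node.job k ∉ S := fun h => hkS ⟨hk, h⟩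
        refine le_top.trans ?_
        calc (⊤ : ENNReal) = if Node.job j ∈ S ∧ Node.job k ∉ S then
              D.netCap U π (.job j) (.job k) else 0 := by simp [hj, hk, hjk, hkS', netCap]
          _ ≤ ∑ b, if Node.job j ∈ S ∧ b ∉ S then D.netCap U π (.job j) b else 0 :=
            Finset.single_le_sum (f := fun b => if Node.job j ∈ S ∧ b ∉ S then
              D.netCap U π (.job j) b else 0) (fun _ _ => zero_le) (Finset.mem_univ _)
          _ ≤ _ := Finset.single_le_sum (f := fun a => ∑ b, if a ∈ S ∧ b ∉ S then
              D.netCap U π a b else 0) (fun _ _ => zero_le) (Finset.mem_univ _)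
    · calc (D.m : ENNReal) = if Node.A ∈ S ∧ Node.B ∉ S then
            D.netCap U π .A .B else 0 := by simp [hA, hB, netCap]
        _ ≤ ∑ b, if Node.A ∈ S ∧ b ∉ S then D.netCap U π .A b else 0 :=
          Finset.single_le_sum (f := fun b => if Node.A ∈ S ∧ b ∉ S then
            D.netCap U π .A b else 0) (fun _ _ => zero_le) (Finset.mem_univ _)
        _ ≤ _ := Finset.single_le_sum (f := fun a => ∑ b, if a ∈ S ∧ b ∉ S then
            D.netCap U π a b else 0) (fun _ _ => zero_le) (Finset.mem_univ _)

/-- The largest parameter for which `{A}` is a minimum cut has a further minimum cut. -/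
lemma exists_tight (hπ : IsGreatest
    {π | 0 < π ∧ IsMinCut (D.netCap U π) Node.A Node.Z {Node.A}} π) :
    ∃ T, D.ClosedIn U T ∧ D.jobCut U π T = D.m := by
  obtain ⟨⟨hπ0, hcut⟩, hmax⟩ := hπ
  rw [D.isMinCut_singleton_iff hπ0] at hcut
  by_contra! hne
  -- If all of the finitely many cuts were slack, they would by continuity stay slack for slightly
  -- larger parameters.
  have hev : ∀ᶠ π' in nhdsWithin π (Set.Ioi π),
      ∀ T, D.ClosedIn U T → (D.m : ℝ) ≤ D.jobCut U π' T := by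
    rw [Filter.eventually_all]
    intro T
    by_cases hT : D.ClosedIn U T
    · have hlt : (D.m : ℝ) < D.jobCut U π T := lt_of_le_of_ne (hcut T hT) (hne T hT).symm
      have hc : ContinuousAt (fun π' => D.jobCut U π' T) π := by
        unfold jobCut
        exact continuousAt_const.add (continuousAt_const.div continuousAt_id hπ0.ne')
      filter_upwards [nhdsWithin_le_nhds (hc.eventually (lt_mem_nhds hlt))] with π' h _ using h.le
    · exact Filter.Eventually.of_forall fun _ h => absurd h hT
  obtain ⟨π', h1, h2⟩ := (hev.and self_mem_nhdsWithin).exists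
  have hπ' : 0 < π' := hπ0.trans h2
  exact absurd (hmax ⟨hπ', (D.isMinCut_singleton_iff hπ').2 h1⟩) (not_le.2 h2)

/-- The cut of `T` bounds `π` only if `N T > 0`, and then by `w(T) / N T`. The largest parameter is
the minimum of these finitely many ratios. It is positive because `N ∅ < 0` forces the minimizer to
be nonempty. -/
lemma exists_isGreatest (hw : ∀ j, 0 < D.w j) (hU : D.m < (D.available U).card) :
    ∃ π, IsGreatest {π | 0 < π ∧ IsMinCut (D.netCap U π) Node.A Node.Z {Node.A}} π := by
  classical
  let N : Finset ι → ℝ := fun T => D.m - (D.available U \ T).card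
  let 𝒯 : Finset (Finset ι) := {T | D.ClosedIn U T ∧ 0 < N T}
  have hm0 : (0 : ℝ) < D.m := by exact_mod_cast D.m_pos
  have hmem : ∀ T, T ∈ 𝒯 ↔ D.ClosedIn U T ∧ 0 < N T := fun T => by simp [𝒯]
  have hUmem : U ∈ 𝒯 := (hmem U).2
    ⟨⟨subset_rfl, fun _ _ _ _ h => h⟩, by simp [N, Finset.sdiff_eq_empty_iff_subset.2
      D.available_subset, hm0]⟩
  obtain ⟨T₀, hT₀, hmin⟩ := 𝒯.exists_min_image (fun T => (∑ j ∈ T, D.w j) / N T) ⟨U, hUmem⟩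
  have hiff : ∀ π, 0 < π → ∀ T, 0 < N T →
      ((D.m : ℝ) ≤ D.jobCut U π T ↔ π ≤ (∑ j ∈ T, D.w j) / N T) := fun π hπ T hT => by
    rw [jobCut, le_div_iff₀ hT, ← sub_le_iff_le_add', le_div_iff₀ hπ, mul_comm]
  have hpos : 0 < (∑ j ∈ T₀, D.w j) / N T₀ := by
    have h0 := ((hmem T₀).1 hT₀).2
    refine div_pos (Finset.sum_pos (fun j _ => hw j) ?_) h0
    rw [Finset.nonempty_iff_ne_empty]
    rintro rfl
    simp only [N, Finset.sdiff_empty, sub_pos, Nat.cast_lt] at h0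
    omega
  refine ⟨_, ⟨hpos, (D.isMinCut_singleton_iff hpos).2 fun T hT => ?_⟩, fun π hπ => ?_⟩
  · by_cases h : 0 < N T
    · exact (hiff _ hpos T h).2 (hmin T ((hmem T).2 ⟨hT, h⟩))
    · have : 0 ≤ (∑ j ∈ T, D.w j) / ((∑ j ∈ T₀, D.w j) / N T₀) :=
        div_nonneg (Finset.sum_nonneg fun j _ => D.w_nonneg j) hpos.le
      simp only [N] at h
      unfold jobCut
      linarith
  · have h0 := (hmem T₀).1 hT₀
    exact (hiff π hπ.1 T₀ h0.2).1 ((D.isMinCut_singleton_iff hπ.1).1 hπ.2 T₀ h0.1)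

lemma exists_flow_of_isMinCut (h : IsMinCut (D.netCap U π) Node.A Node.Z {Node.A}) :
    ∃ x, IsFlow (D.netCap U π) Node.A Node.Z x ∧ (D.m : ℝ) ≤ flowValue Node.A x := by
  refine exists_flow_of_le_cutCapacity (by simp) fun S hA hZ => ?_
  rw [ENNReal.ofReal_natCast, ← D.cutCapacity_singleton (U := U) (π := π)]
  exact h.2.2 S hA hZ


end KnownData

end

/-! ### Flows in the job network and the properties of the rates -/

namespace KnownData

variable {ι : Type*} [Fintype ι] (D : KnownData ι) {U T : Finset ι} {π : ℝ}

/-- The equations and inequalities that say that `x` is a flow for the capacities `netCap U π`. -/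
structure FlowFacts (U : Finset ι) (π : ℝ) (x : Node ι → Node ι → ℝ) : Prop where
  nonneg : ∀ a b, 0 ≤ x a b
  value_eq : flowValue .A x = ∑ j, x .B (.job j)
  value_le : flowValue .A x ≤ D.m
  rate_le : ∀ j, x .B (.job j) ≤ 1
  rate_eq_zero : ∀ j, j ∉ D.available U → x .B (.job j) = 0
  sink_le : ∀ j, x (.job j) .Z ≤ D.w j / π
  sink_eq_zero : ∀ j, j ∉ U → x (.job j) .Z = 0
  arc_eq_zero : ∀ j k, ¬ (j ∈ U ∧ k ∈ U ∧ D.prec j k) → x (.job j) (.job k) = 0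
  conserve : ∀ j, x .B (.job j) + ∑ i, x (.job i) (.job j) =
    x (.job j) .Z + ∑ k, x (.job j) (.job k)

variable {D}

lemma flowFacts {x : Node ι → Node ι → ℝ} (hπ : 0 < π)
    (hx : IsFlow (D.netCap U π) Node.A Node.Z x) : D.FlowFacts U π x := by
  have hzero : ∀ a b, D.netCap U π a b = 0 → x a b = 0 := fun a b h => by
    have := hx.le_cap a b
    rw [h, nonpos_iff_eq_zero, ENNReal.ofReal_eq_zero] at this
    exact le_antisymm this (hx.nonneg a b)
  have hAA := hzero .A .A rfl
  have hAZ := hzero .A .Z rfl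
  have hBA := hzero .B .A rfl
  have hBB := hzero .B .B rfl
  have hBZ := hzero .B .Z rfl
  have hZA := hzero .Z .A rfl
  have hZB := hzero .Z .B rfl
  have hAj := fun j => hzero .A (.job j) rfl
  have hZj := fun j => hzero .Z (.job j) rfl
  have hjA := fun j => hzero (.job j) .A rfl
  have hjB := fun j => hzero (.job j) .B rfl
  have hval : flowValue .A x = x .A .B := by
    simp [flowValue, Node.sum_eq, hAA, hAZ, hBA, hZA, hAj, hjA]
  have hB := hx.conserve .B (by simp) (by simp)
  simp only [Node.sum_eq, hBB, hZB, hjB, hBA, hBZ, Finset.sum_const_zero, add_zero, zero_add] at hB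
  refine ⟨hx.nonneg, hval.trans hB, ?_, fun j => ?_, fun j hj => hzero _ _ (by simp [netCap, hj]),
    fun j => ?_, fun j hj => hzero _ _ (by simp [netCap, hj]),
    fun j k h => hzero _ _ (by simp only [netCap, if_neg h]), fun j => ?_⟩
  · have := hx.le_cap .A .B
    simp only [netCap] at this
    rw [hval, ← ENNReal.ofReal_le_ofReal_iff (by positivity), ENNReal.ofReal_natCast]
    exact this
  · have := hx.le_cap .B (.job j)
    rw [← ENNReal.ofReal_le_ofReal_iff zero_le_one, ENNReal.ofReal_one]
    refine this.trans ?_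
    simp only [netCap]
    split_ifs <;> simp
  · have := hx.le_cap (.job j) .Z
    rw [← ENNReal.ofReal_le_ofReal_iff (div_nonneg (D.w_nonneg j) hπ.le)]
    refine this.trans ?_
    simp only [netCap]
    split_ifs <;> simp
  · have := hx.conserve (.job j) (by simp) (by simp)
    simpa only [Node.sum_eq, hAj, hZj, hjA, hjB, zero_add] using this

open Classical in
lemma FlowFacts.sum_conserve {x : Node ι → Node ι → ℝ} (hx : D.FlowFacts U π x) (P : Finset ι) :
    ∑ j ∈ P, x .B (.job j) + ∑ j ∈ P, ∑ i ∈ Pᶜ, x (.job i) (.job j) =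
      ∑ j ∈ P, x (.job j) .Z + ∑ j ∈ P, ∑ k ∈ Pᶜ, x (.job j) (.job k) := by
  have h := Finset.sum_congr (rfl : P = P) fun j _ => hx.conserve j
  have hs : ∀ f : ι → ℝ, ∑ b, f b = ∑ b ∈ P, f b + ∑ b ∈ Pᶜ, f b := fun f =>
    (Finset.sum_add_sum_compl P f).symm
  simp only [hs, Finset.sum_add_distrib] at h
  rw [Finset.sum_comm (s := P) (t := P)] at h
  linarith

/-- Flow enters a predecessor-closed set only from `B`. -/
lemma FlowFacts.sum_sink_le {x : Node ι → Node ι → ℝ} (hx : D.FlowFacts U π x) {P : Finset ι}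
    (hP : ∀ j k, D.prec j k → k ∈ P → j ∈ P) :
    ∑ j ∈ P, x (.job j) .Z ≤ ∑ j ∈ P, x .B (.job j) := by
  classical
  have h := hx.sum_conserve P
  rw [Finset.sum_eq_zero (f := fun j => ∑ i ∈ Pᶜ, x (.job i) (.job j))] at h
  · have : 0 ≤ ∑ j ∈ P, ∑ k ∈ Pᶜ, x (.job j) (.job k) :=
      Finset.sum_nonneg fun _ _ => Finset.sum_nonneg fun _ _ => hx.nonneg _ _
    linarith
  · exact fun j hj => Finset.sum_eq_zero fun i hi => hx.arc_eq_zero _ _ fun h =>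
      Finset.mem_compl.1 hi (hP i j h.2.2 hj)

/-- Flow leaves a successor-closed set only to `Z`. -/
lemma FlowFacts.sum_rate_le {x : Node ι → Node ι → ℝ} (hx : D.FlowFacts U π x)
    (hT : D.ClosedIn U T) : ∑ j ∈ T, x .B (.job j) ≤ ∑ j ∈ T, x (.job j) .Z := by
  classical
  have h := hx.sum_conserve T
  rw [Finset.sum_eq_zero (f := fun j => ∑ k ∈ Tᶜ, x (.job j) (.job k))] at h
  · have : 0 ≤ ∑ j ∈ T, ∑ i ∈ Tᶜ, x (.job i) (.job j) :=
      Finset.sum_nonneg fun _ _ => Finset.sum_nonneg fun _ _ => hx.nonneg _ _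
    linarith
  · exact fun j hj => Finset.sum_eq_zero fun k hk => hx.arc_eq_zero _ _ fun h =>
      Finset.mem_compl.1 hk (hT.2 j k h.2.2 hj h.2.1)

lemma FlowFacts.sum_sink_eq {x : Node ι → Node ι → ℝ} (hx : D.FlowFacts U π x) :
    ∑ j, x (.job j) .Z = ∑ j, x .B (.job j) := by
  classical
  simpa using (hx.sum_conserve Finset.univ).symm

open Classical in
lemma FlowFacts.sum_rate_eq {x : Node ι → Node ι → ℝ} (hx : D.FlowFacts U π x) (T : Finset ι) :
    ∑ j, x .B (.job j) =
      ∑ j ∈ T, x .B (.job j) + ∑ j ∈ D.available U \ T, x .B (.job j) := by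
  rw [← Finset.sum_add_sum_compl T]
  congr 1
  symm
  refine Finset.sum_subset (fun j hj => ?_) fun j hj hj' => hx.rate_eq_zero j fun h => ?_
  · exact Finset.mem_compl.2 (Finset.mem_sdiff.1 hj).2
  · exact hj' (Finset.mem_sdiff.2 ⟨h, Finset.mem_compl.1 hj⟩)

/-- A flow of value `m` saturates every arc that crosses a tight cut. -/
lemma FlowFacts.saturated {x : Node ι → Node ι → ℝ} (hx : D.FlowFacts U π x)
    (hm : (D.m : ℝ) ≤ flowValue .A x) (hT : D.ClosedIn U T) (hcut : D.jobCut U π T = D.m) :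
    (∀ j ∈ D.available U, j ∉ T → x .B (.job j) = 1) ∧ ∀ j ∈ T, x (.job j) .Z = D.w j / π := by
  classical
  have h1 := hx.sum_rate_eq T
  have h2 := hx.sum_rate_le hT
  have h3 : ∑ j ∈ T, x (.job j) .Z ≤ ∑ j ∈ T, D.w j / π := Finset.sum_le_sum fun j _ => hx.sink_le j
  have h4 : ∑ j ∈ D.available U \ T, x .B (.job j) ≤ ∑ j ∈ D.available U \ T, (1 : ℝ) :=
    Finset.sum_le_sum fun j _ => hx.rate_le j
  rw [hx.value_eq] at hm
  -- The upper bounds on the terms add up to exactly `m`, so each of them is attained.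
  have h5 : ∑ j ∈ D.available U \ T, (1 : ℝ) + ∑ j ∈ T, D.w j / π = D.m := by
    rw [← hcut, jobCut, Finset.sum_div]
    simp
  refine ⟨fun j hj hjT => ?_, fun j hj => ?_⟩
  · exact (Finset.sum_eq_sum_iff_of_le fun j _ => hx.rate_le j).1 (by linarith) j
      (Finset.mem_sdiff.2 ⟨hj, hjT⟩)
  · exact (Finset.sum_eq_sum_iff_of_le fun j _ => hx.sink_le j).1 (by linarith) j hj

lemma le_flowValue_of_isMaxFlow {x : Node ι → Node ι → ℝ}
    (h : IsMinCut (D.netCap U π) Node.A Node.Z {Node.A})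
    (hx : IsMaxFlow (D.netCap U π) Node.A Node.Z x) : (D.m : ℝ) ≤ flowValue .A x := by
  obtain ⟨y, hy, hm⟩ := D.exists_flow_of_isMinCut h
  exact hm.trans (hx.2 y hy)

variable (D) in
theorem exists_isRateChoice (hw : ∀ j, 0 < D.w j) (U : Finset ι) : ∃ r, D.IsRateChoice U r := by
  rcases le_or_gt (D.available U).card D.m with h | h
  · exact ⟨1, Or.inl ⟨h, fun _ _ => rfl⟩⟩
  · obtain ⟨π, hπ⟩ := D.exists_isGreatest hw h
    obtain ⟨x, hx, hm⟩ := D.exists_flow_of_isMinCut hπ.1.2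
    exact ⟨fun j => x .B (.job j), Or.inr ⟨h, π, hπ, x,
      ⟨hx, fun y hy => (flowFacts hπ.1.1 hy).value_le.trans hm⟩, fun _ _ => rfl⟩⟩

/-- Computed rates are feasible, and some job is processed. -/
lemma IsRateChoice.feasible {r : ι → ℝ} (h : D.IsRateChoice U r) (hU : (D.available U).Nonempty) :
    (∀ j ∈ D.available U, 0 ≤ r j ∧ r j ≤ 1) ∧ ∑ j ∈ D.available U, r j ≤ D.m ∧
      ∃ j ∈ D.available U, 0 < r j := by
  classical
  rcases h with ⟨hc, hr⟩ | ⟨-, π, hπ, x, hx, hr⟩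
  · refine ⟨fun j hj => by simp [hr j hj], ?_, ?_⟩
    · rw [Finset.sum_congr rfl hr]
      simpa using hc
    · obtain ⟨j, hj⟩ := hU
      exact ⟨j, hj, by simp [hr j hj]⟩
  · have hf := flowFacts hπ.1.1 hx.1
    have hs : ∑ j ∈ D.available U, r j = ∑ j, x .B (.job j) := by
      rw [Finset.sum_congr rfl hr, hf.sum_rate_eq ∅]
      simp
    have hm := le_flowValue_of_isMaxFlow hπ.1.2 hx
    refine ⟨fun j hj => by rw [hr j hj]; exact ⟨hf.nonneg _ _, hf.rate_le j⟩, ?_, ?_⟩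
    · rw [hs, ← hf.value_eq]
      exact hf.value_le
    · have hm0 : (0 : ℝ) < D.m := by exact_mod_cast D.m_pos
      by_contra! hle
      have := Finset.sum_nonpos hle
      rw [hs, ← hf.value_eq] at this
      linarith

variable (D) in
open Classical in
/-- For the rates `r`, the amount `y k` is processed for the benefit of the unfinished job `k`, and
the job set `T` is the part of `U` that does not have all its available ancestors running at full
speed. -/
structure IsServed (U : Finset ι) (r y : ι → ℝ) (T : Finset ι) : Prop where
  nonneg : ∀ k, 0 ≤ y k
  closedIn : D.ClosedIn U T
  rate_eq_one : ∀ j ∈ D.available U, j ∉ T → r j = 1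
  sum_le : ∀ P : Finset ι, (∀ j k, D.prec j k → k ∈ P → j ∈ P) →
    ∑ k ∈ P, y k ≤ ∑ j ∈ P with j ∈ D.available U, r j
  weight_mul_le : ∀ k ∈ T, ∀ l, D.w k * y l ≤ D.w l * y k
  weight_le : (∑ k ∈ T, D.w k) * D.m ≤ (∑ k ∈ T, D.w k) * ∑ l, y l

/-- Here `y` is the flow into the sink and `T` a tight set; on `T` the ratio `y k / w k` has its
largest possible value `1 / π`. The weight factor in `weight_le` lets `y = 0`, `T = ∅` serve when
there are at most `m` available jobs. -/
lemma IsRateChoice.exists_isServed {r : ι → ℝ} (h : D.IsRateChoice U r) :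
    ∃ y T, D.IsServed U r y T := by
  classical
  rcases h with ⟨hc, hr⟩ | ⟨-, π, hπ, x, hx, hr⟩
  · refine ⟨0, ∅, fun _ => le_rfl, ⟨Finset.empty_subset _, by simp⟩, fun j hj _ => hr j hj,
      fun P _ => ?_, by simp, by simp⟩
    simp only [Pi.zero_apply, Finset.sum_const_zero]
    exact Finset.sum_nonneg fun j hj => by simp [hr j (Finset.mem_filter.1 hj).2]
  · have hf := flowFacts hπ.1.1 hx.1
    have hm := le_flowValue_of_isMaxFlow hπ.1.2 hx
    have hπ0 : 0 < π := hπ.1.1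
    obtain ⟨T, hT, hcut⟩ := D.exists_tight hπ
    obtain ⟨h1, h2⟩ := hf.saturated hm hT hcut
    refine ⟨fun k => x (.job k) .Z, T, fun _ => hf.nonneg _ _, hT,
      fun j hj hjT => (hr j hj).trans (h1 j hj hjT), fun P hP => (hf.sum_sink_le hP).trans ?_,
      fun k hk l => ?_, ?_⟩
    · rw [Finset.sum_filter]
      refine Finset.sum_le_sum fun j _ => ?_
      split_ifs with hj
      · exact (hr j hj).ge
      · exact (hf.rate_eq_zero j hj).le
    · rw [h2 k hk]
      have := mul_le_mul_of_nonneg_left (hf.sink_le l) (D.w_nonneg k)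
      calc _ ≤ _ := this
        _ = _ := by ring
    · refine mul_le_mul_of_nonneg_left ?_ (Finset.sum_nonneg fun j _ => D.w_nonneg j)
      rw [hf.sum_sink_eq, ← hf.value_eq]
      exact hm

end KnownData

/-! ### Functions of the set of unfinished jobs -/

section

variable {ι : Type*} [Fintype ι]

@[simp]
lemma mem_unfinished {C : ι → ℝ} {t : ℝ} {j : ι} : j ∈ unfinished C t ↔ t < C j := by
  simp [unfinished]

lemma measurableSet_unfinished_eq (C : ι → ℝ) (U : Finset ι) :
    MeasurableSet {t | unfinished C t = U} := by
  have : {t | unfinished C t = U} = ⋂ j, {t | t < C j ↔ j ∈ U} := by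
    ext t
    simp [Finset.ext_iff]
  rw [this]
  refine MeasurableSet.iInter fun j => ?_
  by_cases hj : j ∈ U
  · simp only [hj, iff_true]
    exact measurableSet_Iio
  · simp only [hj, iff_false, not_lt]
    exact measurableSet_Ici

lemma intervalIntegrable_unfinished (C : ι → ℝ) (g : Finset ι → ℝ) (a b : ℝ) :
    IntervalIntegrable (fun t => g (unfinished C t)) volume a b := by
  classical
  have hg : (fun t => g (unfinished C t)) =
      fun t => ∑ U, ({t | unfinished C t = U}.indicator (fun _ => g U) t) := by
    ext t
    simp [Set.indicator_apply]
  have hmeas : Measurable (fun t => g (unfinished C t)) := by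
    rw [hg]
    exact Finset.measurable_sum _ fun U _ =>
      measurable_const.indicator (measurableSet_unfinished_eq C U)
  refine (intervalIntegrable_const (c := ∑ U, |g U|)).mono_fun hmeas.aestronglyMeasurable
    (Filter.Eventually.of_forall fun t => ?_)
  simp only [Real.norm_eq_abs]
  refine le_trans ?_ (le_abs_self _)
  exact Finset.single_le_sum (f := fun U => |g U|) (fun _ _ => abs_nonneg _) (Finset.mem_univ _)

namespace KnownData

variable (D : KnownData ι)

lemma wellFounded_prec : WellFounded D.prec := by
  have : IsStrictOrder ι (Relation.TransGen D.prec) :=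
    { irrefl := D.acyclic, trans := fun _ _ _ => Relation.TransGen.trans }
  exact Subrelation.wf (fun h => Relation.TransGen.single h)
    (Finite.wellFounded_of_trans_of_irrefl (Relation.TransGen D.prec))

lemma available_nonempty {U : Finset ι} (hU : U.Nonempty) : (D.available U).Nonempty := by
  obtain ⟨j, hj, hmin⟩ := D.wellFounded_prec.has_min (U : Set ι) hU
  exact ⟨j, D.mem_available.2 ⟨hj, fun k hk hkU => hmin k hkU hk⟩⟩

/-! ### Existence of a run for every rule -/

section Existence

open Classical in
/-- The rates that result from a rule when the completion times are `C`. -/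
def ruleRate (σ : Finset ι → ι → ℝ) (C : ι → ℝ) (j : ι) (t : ℝ) : ℝ :=
  if j ∈ D.available (unfinished C t) then σ (unfinished C t) j else 0

/-- `C` are the completion times for the rates that are determined by `C` and the rule `σ`. -/
def IsCompletion (σ : Finset ι → ι → ℝ) (p C : ι → ℝ) : Prop :=
  ∀ j, IsLeast {t | 0 ≤ t ∧ (∀ k, D.prec k j → C k ≤ t) ∧
    p j ≤ elapsed (D.ruleRate σ C j) t} (C j)

variable {D} {σ : Finset ι → ι → ℝ}

lemma intervalIntegrable_ruleRate (C : ι → ℝ) (j : ι) (a b : ℝ) :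
    IntervalIntegrable (D.ruleRate σ C j) volume a b := by
  classical
  exact intervalIntegrable_unfinished C (fun U => if j ∈ D.available U then σ U j else 0) a b

open Classical in
/-- The completion times after the jobs of `U` have run at constant rates for the time `δ`. -/
def delay (U : Finset ι) (δ : ℝ) (C : ι → ℝ) (j : ι) : ℝ := if j ∈ U then C j + δ else 0

variable {U : Finset ι} {C : ι → ℝ} {δ : ℝ}

lemma unfinished_delay_of_lt (hC : ∀ j, 0 ≤ C j) {t : ℝ} (ht0 : 0 ≤ t) (ht : t < δ) :
    unfinished (delay U δ C) t = U := by
  ext j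
  have := hC j
  rw [mem_unfinished, delay]
  split_ifs with h
  · simp only [h, iff_true]; linarith
  · simp only [h, iff_false]; linarith

lemma unfinished_delay_add (hδ : 0 ≤ δ) (hCU : ∀ j, j ∉ U → C j = 0) {t : ℝ} (ht0 : 0 ≤ t) :
    unfinished (delay U δ C) (t + δ) = unfinished C t := by
  ext j
  rw [mem_unfinished, mem_unfinished, delay]
  split_ifs with h
  · simp
  · rw [hCU j h]
    constructor <;> intro <;> linarith

open Classical in
lemma elapsed_delay_of_le (hC : ∀ j, 0 ≤ C j) (j : ι) {t : ℝ} (ht0 : 0 ≤ t) (ht : t ≤ δ) :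
    elapsed (D.ruleRate σ (delay U δ C) j) t =
      t * if j ∈ D.available U then σ U j else 0 := by
  have : ∀ s ∈ Set.Ioo 0 t, D.ruleRate σ (delay U δ C) j s =
      if j ∈ D.available U then σ U j else 0 := fun s hs => by
    rw [ruleRate, unfinished_delay_of_lt hC hs.1.le (hs.2.trans_le ht)]
  rw [elapsed, intervalIntegral.integral_of_le ht0, integral_Ioc_eq_integral_Ioo,
    setIntegral_congr_fun measurableSet_Ioo this]
  simp [ht0]

open Classical in
lemma elapsed_delay_add (hC : ∀ j, 0 ≤ C j) (hδ : 0 ≤ δ) (hCU : ∀ j, j ∉ U → C j = 0) (j : ι)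
    {t : ℝ} (ht0 : 0 ≤ t) :
    elapsed (D.ruleRate σ (delay U δ C) j) (t + δ) =
      δ * (if j ∈ D.available U then σ U j else 0) + elapsed (D.ruleRate σ C j) t := by
  rw [← elapsed_delay_of_le (D := D) (σ := σ) hC j hδ le_rfl, elapsed, elapsed, elapsed,
    ← intervalIntegral.integral_add_adjacent_intervals (intervalIntegrable_ruleRate _ j 0 δ)
      (intervalIntegrable_ruleRate _ j δ (t + δ))]
  congr 1
  have h := intervalIntegral.integral_comp_add_right (a := 0) (b := t)
    (D.ruleRate σ (delay U δ C) j) δ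
  rw [zero_add] at h
  rw [← h]
  refine intervalIntegral.integral_congr fun s hs => ?_
  rw [Set.uIcc_of_le ht0] at hs
  simp only [ruleRate, unfinished_delay_add hδ hCU hs.1]

lemma IsCompletion.nonneg {p : ι → ℝ} (h : D.IsCompletion σ p C) (j : ι) : 0 ≤ C j := (h j).1.1

lemma SuccClosed.erase [DecidableEq ι] (hU : D.SuccClosed U) {j : ι} (hj : j ∈ D.available U) :
    D.SuccClosed (U.erase j) := by
  intro i k hik hi
  rw [Finset.mem_erase] at hi ⊢
  refine ⟨?_, hU i k hik hi.2⟩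
  rintro rfl
  exact (D.mem_available.1 hj).2 i hik hi.2

-- The induction step: the available jobs run at constant rates for the time `δ`, then the schedule
-- for the remaining times `q` follows. By `hpos` and `hle` no job of `U` completes before `δ`.
open Classical in
lemma IsCompletion.delay {p : ι → ℝ} (hU : D.SuccClosed U) (hpU : ∀ j, j ∉ U → p j = 0)
    (hδ : 0 ≤ δ) (hpos : ∀ j ∈ D.available U, 0 < p j)
    (hle : ∀ j ∈ D.available U, 0 < σ U j → δ * σ U j ≤ p j)
    (hσ : ∀ j ∈ D.available U, 0 ≤ σ U j) {q : ι → ℝ}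
    (hq : ∀ j, q j = p j - δ * if j ∈ D.available U then σ U j else 0)
    (hCU : ∀ j, j ∉ U → C j = 0) (h : D.IsCompletion σ q C) :
    D.IsCompletion σ p (delay U δ C) := by
  have hC := h.nonneg
  intro j
  by_cases hj : j ∈ U
  · have hCj : KnownData.delay U δ C j = C j + δ := if_pos hj
    obtain ⟨⟨h1, h2, h3⟩, h4⟩ := h j
    rw [hCj]
    refine ⟨⟨by linarith, fun k hk => ?_, ?_⟩, fun t ⟨ht0, ht, hpt⟩ => ?_⟩
    · have := h2 k hk
      rw [KnownData.delay]
      split_ifs <;> linarith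
    · rw [elapsed_delay_add hC hδ hCU j h1]
      rw [hq] at h3
      linarith
    · rcases le_or_gt δ t with hδt | htδ
      · have ht' : 0 ≤ t - δ := by linarith
        have := h4 (a := t - δ) ⟨ht', fun k hk => ?_, ?_⟩
        · linarith
        · by_cases hkU : k ∈ U
          · have := ht k hk
            rw [KnownData.delay, if_pos hkU] at this
            linarith
          · rw [hCU k hkU]
            exact ht'
        · have h5 := elapsed_delay_add (D := D) (σ := σ) hC hδ hCU j ht'
          rw [sub_add_cancel] at h5
          rw [h5] at hpt
          rw [hq]
          linarith
      · exfalso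
        rw [elapsed_delay_of_le hC j ht0 htδ.le] at hpt
        by_cases hjF : j ∈ D.available U
        · rw [if_pos hjF] at hpt
          have hp := hpos j hjF
          rcases (hσ j hjF).eq_or_lt with h0 | h0
          · rw [← h0, mul_zero] at hpt
            linarith
          · have := hle j hjF h0
            have := mul_lt_mul_of_pos_right htδ h0
            linarith
        · rw [D.mem_available] at hjF
          push Not at hjF
          obtain ⟨k, hk, hkU⟩ := hjF hj
          have := ht k hk
          have := hC k
          rw [KnownData.delay, if_pos hkU] at *
          linarith
  · have hCj : KnownData.delay U δ C j = 0 := if_neg hj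
    rw [hCj]
    refine ⟨⟨le_rfl, fun k hk => ?_, by simp [hpU j hj, elapsed]⟩, fun t ht => ht.1⟩
    rw [KnownData.delay, if_neg fun hkU => hj (hU k j hk hkU)]

/-- For every rule there are completion times, provided that only the jobs of `U` have to be
processed. -/
theorem exists_isCompletion
    (hσ : ∀ U : Finset ι, U.Nonempty → D.SuccClosed U → D.IsRateChoice U (σ U)) (U : Finset ι) :
    D.SuccClosed U → ∀ p : ι → ℝ, (∀ j, 0 ≤ p j) → (∀ j, j ∉ U → p j = 0) →
      ∃ C, D.IsCompletion σ p C ∧ ∀ j, j ∉ U → C j = 0 := by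
  classical
  induction U using Finset.strongInduction with
  | H U ih =>
    intro hU p hp hpU
    rcases U.eq_empty_or_nonempty with rfl | hne
    · refine ⟨0, fun j => ⟨⟨le_rfl, fun _ _ => le_rfl, ?_⟩, fun t ht => ht.1⟩, fun _ _ => rfl⟩
      simp [hpU j (by simp), elapsed]
    have hF := D.available_nonempty hne
    -- An available job without remaining processing time completes at once and is removed without
    -- letting time pass.
    by_cases hz : ∃ j ∈ D.available U, p j = 0
    · obtain ⟨j, hj, hpj⟩ := hz
      obtain ⟨C, hC, hC0⟩ := ih (U.erase j) (Finset.erase_ssubset (D.available_subset hj))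
        (hU.erase hj) p hp fun k hk => by
          by_cases hkj : k = j
          · rw [hkj, hpj]
          · exact hpU k fun h => hk (Finset.mem_erase.2 ⟨hkj, h⟩)
      exact ⟨C, hC, fun k hk => hC0 k fun h => hk (Finset.mem_of_mem_erase h)⟩
    · push Not at hz
      have hpos : ∀ j ∈ D.available U, 0 < p j := fun j hj => (hp j).lt_of_ne (hz j hj).symm
      obtain ⟨hr, -, j₁, hj₁, hr₁⟩ := (hσ U hne hU).feasible hF
      obtain ⟨j, hj, hmin⟩ := ({j ∈ D.available U | 0 < σ U j}).exists_min_image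
        (fun j => p j / σ U j) ⟨j₁, by simp [hj₁, hr₁]⟩
      simp only [Finset.mem_filter] at hj hmin
      -- The first time at which an available job finishes. Further jobs finishing at the same time
      -- are left to the zero case.
      set δ := p j / σ U j with hδ
      have hδ0 : 0 < δ := div_pos (hpos j hj.1) hj.2
      have hle : ∀ i ∈ D.available U, 0 < σ U i → δ * σ U i ≤ p i := fun i hi h =>
        (le_div_iff₀ h).1 (hmin i ⟨hi, h⟩)
      have hq0 : ∀ i, 0 ≤ p i - δ * if i ∈ D.available U then σ U i else 0 := fun i => by
        split_ifs with hi
        · rcases (hr i hi).1.eq_or_lt with h | h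
          · rw [← h]
            simpa using hp i
          · linarith [hle i hi h]
        · simpa using hp i
      obtain ⟨C, hC, hC0⟩ := ih (U.erase j) (Finset.erase_ssubset (D.available_subset hj.1))
        (hU.erase hj.1) (fun i => p i - δ * if i ∈ D.available U then σ U i else 0) hq0
        fun k hk => by
          by_cases hkj : k = j
          · rw [hkj, if_pos hj.1, hδ, div_mul_cancel₀ _ hj.2.ne', sub_self]
          · have hkU : k ∉ U := fun h => hk (Finset.mem_erase.2 ⟨hkj, h⟩)
            rw [hpU k hkU, if_neg fun h => hkU (D.available_subset h), mul_zero, sub_zero]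
      exact ⟨KnownData.delay U δ C, hC.delay hU hpU hδ0.le hpos hle (fun i hi => (hr i hi).1)
        (fun i => rfl) fun k hk => hC0 k fun h => hk (Finset.mem_of_mem_erase h),
        fun k hk => if_neg hk⟩

theorem exists_isRun
    (hσ : ∀ U : Finset ι, U.Nonempty → D.SuccClosed U → D.IsRateChoice U (σ U))
    {p : ι → ℝ} (hp : ∀ j, 0 ≤ p j) : ∃ (R : ι → ℝ → ℝ) (C : ι → ℝ), D.IsRun p R C ∧
      ∀ t, 0 ≤ t → ∀ j ∈ D.available (unfinished C t), R j t = σ (unfinished C t) j := by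
  classical
  obtain ⟨C, hC, -⟩ := exists_isCompletion hσ Finset.univ (fun _ _ _ _ => Finset.mem_univ _) p hp
    (by simp)
  have heq : ∀ t, ∀ j ∈ D.available (unfinished C t), D.ruleRate σ C j t = σ (unfinished C t) j :=
    fun t j hj => if_pos hj
  have hcl : ∀ t, D.SuccClosed (unfinished C t) := fun t j k hjk hj => by
    rw [mem_unfinished] at hj ⊢
    exact hj.trans_le ((hC k).1.2.1 j hjk)
  have hchoice : ∀ t, (unfinished C t).Nonempty →
      D.IsRateChoice (unfinished C t) (σ (unfinished C t)) := fun t ht => hσ _ ht (hcl t)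
  have hrate : ∀ j t, 0 ≤ D.ruleRate σ C j t ∧ D.ruleRate σ C j t ≤ 1 := fun j t => by
    rw [ruleRate]
    split_ifs with hj
    · exact ((hchoice t ⟨j, D.available_subset hj⟩).feasible ⟨j, hj⟩).1 j hj
    · simp
  refine ⟨D.ruleRate σ C, C, ⟨⟨fun j t _ => intervalIntegrable_ruleRate C j 0 t,
    fun j t _ => (hrate j t).1, fun j t _ => (hrate j t).2, fun t _ => ?_,
    fun j t _ hj => if_neg hj, hC⟩, fun t _ hne => ?_, fun s t _ _ hst j => ?_⟩, fun t _ => heq t⟩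
  · simp only [ruleRate, Finset.sum_ite_mem, Finset.univ_inter]
    rcases (D.available (unfinished C t)).eq_empty_or_nonempty with h | h
    · simp [h]
    · exact ((hchoice t (h.mono D.available_subset)).feasible h).2.1
  · rcases hchoice t hne with h | ⟨h, π, hπ, x, hx, hr⟩
    · exact Or.inl ⟨h.1, fun j hj => (heq t j hj).trans (h.2 j hj)⟩
    · exact Or.inr ⟨h, π, hπ, x, hx, fun j hj => (heq t j hj).trans (hr j hj)⟩
  · simp only [ruleRate, hst]

end Existence

end KnownData

end

/-! ### Competitive analysis -/

namespace KnownData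

variable {ι : Type*} [Fintype ι] {D : KnownData ι} {p : ι → ℝ} {R : ι → ℝ → ℝ} {C : ι → ℝ}

namespace IsSchedule

lemma completion_nonneg (h : D.IsSchedule p R C) (j : ι) : 0 ≤ C j := (h.completion j).1.1

lemma completion_le_of_prec (h : D.IsSchedule p R C) {j k : ι} (hjk : D.prec j k) : C j ≤ C k :=
  (h.completion k).1.2.1 j hjk

lemma intervalIntegrable (h : D.IsSchedule p R C) (j : ι) {a b : ℝ} (ha : 0 ≤ a) (hb : 0 ≤ b) :
    IntervalIntegrable (R j) volume a b :=
  (h.integrable j a ha).symm.trans (h.integrable j b hb)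

lemma intervalIntegrable_sum (h : D.IsSchedule p R C) (P : Finset ι) {t : ℝ} (ht : 0 ≤ t) :
    IntervalIntegrable (fun s => ∑ j ∈ P, R j s) volume 0 t := by
  have := IntervalIntegrable.sum P fun j _ => h.integrable j t ht
  rwa [show ∑ j ∈ P, R j = fun s => ∑ j ∈ P, R j s from funext fun s => Finset.sum_apply s P R]
    at this

lemma rate_eq_zero_of_le (h : D.IsSchedule p R C) {j : ι} {t : ℝ} (ht0 : 0 ≤ t) (ht : C j ≤ t) :
    R j t = 0 :=
  h.rate_eq_zero j t ht0 fun hj => not_lt.2 ht (mem_unfinished.1 (D.available_subset hj))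

lemma rate_eq_zero_of_prec (h : D.IsSchedule p R C) {j k : ι} (hjk : D.prec j k) {t : ℝ}
    (ht0 : 0 ≤ t) (ht : t < C j) : R k t = 0 :=
  h.rate_eq_zero k t ht0 fun hk => (D.mem_available.1 hk).2 j hjk (mem_unfinished.2 ht)

lemma integral_eq (h : D.IsSchedule p R C) (j : ι) {M : ℝ} (hM : C j ≤ M) :
    ∫ t in (0 : ℝ)..M, R j t = elapsed (R j) (C j) := by
  have hC := h.completion_nonneg j
  rw [elapsed, ← intervalIntegral.integral_add_adjacent_intervals
    (h.intervalIntegrable j le_rfl hC) (h.intervalIntegrable j hC (hC.trans hM)),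
    intervalIntegral.integral_congr (a := C j) (b := M) (g := fun _ => 0)]
  · simp
  · intro t ht
    rw [Set.uIcc_of_le hM] at ht
    exact h.rate_eq_zero_of_le (hC.trans ht.1) ht.1

lemma integral_le_sub (h : D.IsSchedule p R C) (j : ι) {s t : ℝ} (hs : 0 ≤ s) (hst : s ≤ t) :
    ∫ u in s..t, R j u ≤ t - s := by
  calc ∫ u in s..t, R j u ≤ ∫ _ in s..t, (1 : ℝ) :=
        intervalIntegral.integral_mono_on hst (h.intervalIntegrable j hs (hs.trans hst))
          intervalIntegrable_const fun u hu => h.rate_le_one j u (hs.trans hu.1)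
    _ = t - s := by simp

lemma elapsed_sub (h : D.IsSchedule p R C) (j : ι) {s t : ℝ} (hs : 0 ≤ s) (ht : 0 ≤ t) :
    elapsed (R j) t - elapsed (R j) s = ∫ u in s..t, R j u :=
  intervalIntegral.integral_interval_sub_left (h.integrable j t ht) (h.integrable j s hs)

lemma elapsed_le (h : D.IsSchedule p R C) (j : ι) : elapsed (R j) (C j) ≤ C j := by
  simpa [elapsed] using h.integral_le_sub j le_rfl (h.completion_nonneg j)

lemma elapsed_eq_zero_of_prec (h : D.IsSchedule p R C) {j k : ι} (hjk : D.prec j k) :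
    elapsed (R k) (C j) = 0 := by
  rw [elapsed, intervalIntegral.integral_congr_Ioo_of_le (g := fun _ => 0) (h.completion_nonneg j)
    fun t ht => h.rate_eq_zero_of_prec hjk ht.1.le ht.2]
  simp

lemma elapsed_le_of_prec (h : D.IsSchedule p R C) {j k : ι} (hjk : D.prec j k) :
    elapsed (R k) (C k) ≤ C k - C j := by
  have h1 := h.elapsed_sub k (h.completion_nonneg j) (h.completion_nonneg k)
  have h2 := h.integral_le_sub k (h.completion_nonneg j) (h.completion_le_of_prec hjk)
  have h3 := h.elapsed_eq_zero_of_prec hjk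
  linarith

lemma processing_le (h : D.IsSchedule p R C) (j : ι) : p j ≤ C j :=
  (h.completion j).1.2.2.trans (h.elapsed_le j)

lemma add_processing_le (h : D.IsSchedule p R C) {j k : ι} (hjk : D.prec j k) :
    C j + p k ≤ C k := by
  have := h.elapsed_le_of_prec hjk
  have := (h.completion k).1.2.2
  linarith

/-- A job is not processed for longer than its processing time. -/
lemma elapsed_completion_le (h : D.IsSchedule p R C) {j : ι} (hp : 0 ≤ p j) :
    elapsed (R j) (C j) ≤ p j := by
  by_contra! hlt
  have hC := h.completion_nonneg j
  -- Going back by the excess loses at most the excess, as rates are at most 1. The predecessors are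
  -- complete by then, so `t` would be an earlier completion time.
  set t := C j - (elapsed (R j) (C j) - p j) with ht
  have ht0 : 0 ≤ t := by linarith [h.elapsed_le j]
  have h1 := h.elapsed_sub j ht0 hC
  have h2 := h.integral_le_sub j ht0 (by linarith : t ≤ C j)
  have := (h.completion j).2 ⟨ht0, fun k hk => by linarith [h.elapsed_le_of_prec hk],
    (by linarith : p j ≤ elapsed (R j) t)⟩
  linarith

/-- Jobs that are completed until time `s` have total processing time at most `m * s`. -/
lemma sum_processing_le (h : D.IsSchedule p R C) {s : ℝ} (hs : 0 ≤ s) (P : Finset ι)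
    (hP : ∀ j ∈ P, C j ≤ s) : ∑ j ∈ P, p j ≤ D.m * s := by
  calc ∑ j ∈ P, p j ≤ ∑ j ∈ P, ∫ t in (0 : ℝ)..s, R j t := Finset.sum_le_sum fun j hj => by
        rw [h.integral_eq j (hP j hj)]
        exact (h.completion j).1.2.2
    _ = ∫ t in (0 : ℝ)..s, ∑ j ∈ P, R j t :=
        (intervalIntegral.integral_finsetSum fun j _ => h.integrable j s hs).symm
    _ ≤ ∫ _ in (0 : ℝ)..s, (D.m : ℝ) := by
        refine intervalIntegral.integral_mono_on hs
          (h.intervalIntegrable_sum P hs) intervalIntegrable_const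
          fun t ht => ?_
        exact (Finset.sum_le_univ_sum_of_nonneg fun j => h.rate_nonneg j t ht.1).trans
          (h.sum_rate_le t ht.1)
    _ = D.m * s := by simp [mul_comm]

end IsSchedule

/-- If jobs with weights `w` and sizes `q` are completed at the times `c` on a machine of speed `m`,
then each two of them delay one another. -/
lemma sum_min_le {w q c : ι → ℝ} {m : ℝ} (hw : ∀ k, 0 ≤ w k) (hq : ∀ k, 0 ≤ q k)
    (h : ∀ k, ∑ l with c l ≤ c k, q l ≤ m * c k) :
    ∑ k, ∑ l, min (w k * q l) (w l * q k) ≤ 2 * (m * ∑ k, w k * c k) := by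
  classical
  -- `f k l` is the weighted delay that `l` causes to a job `k` completed no earlier. For each pair
  -- one of `f k l`, `f l k` covers the minimum; summing over ordered pairs gives the factor 2.
  let f : ι → ι → ℝ := fun k l => if c l ≤ c k then w k * q l else 0
  have hf : ∑ k, ∑ l, f k l ≤ m * ∑ k, w k * c k := by
    rw [Finset.mul_sum]
    refine Finset.sum_le_sum fun k _ => ?_
    rw [← Finset.sum_filter, ← Finset.mul_sum]
    calc _ ≤ w k * (m * c k) := mul_le_mul_of_nonneg_left (h k) (hw k)
      _ = _ := by ring
  have hmin : ∀ k l, min (w k * q l) (w l * q k) ≤ f k l + f l k := fun k l => by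
    have h1 := mul_nonneg (hw k) (hq l)
    have h2 := mul_nonneg (hw l) (hq k)
    rcases le_total (c l) (c k) with hc | hc
    · refine (min_le_left _ _).trans ?_
      simp only [f, if_pos hc]
      split_ifs <;> linarith
    · refine (min_le_right _ _).trans ?_
      simp only [f, if_pos hc]
      split_ifs <;> linarith
  calc ∑ k, ∑ l, min (w k * q l) (w l * q k) ≤ ∑ k, ∑ l, (f k l + f l k) :=
        Finset.sum_le_sum fun k _ => Finset.sum_le_sum fun l _ => hmin k l
    _ = 2 * ∑ k, ∑ l, f k l := by
        simp only [Finset.sum_add_distrib]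
        rw [Finset.sum_comm (f := fun k l => f l k)]
        ring
    _ ≤ _ := by linarith

variable {M : ℝ} {Y : Finset ι → ι → ℝ} {T : Finset ι → Finset ι}

/-- Since rates stay fixed while the unfinished set does, one choice of `y` and `T` per set works at
all times. This makes the integrands below piecewise constant. -/
lemma IsRun.exists_isServed (h : D.IsRun p R C) :
    ∃ (Y : Finset ι → ι → ℝ) (T : Finset ι → Finset ι), ∀ t, 0 ≤ t →
      D.IsServed (unfinished C t) (fun j => R j t) (Y (unfinished C t)) (T (unfinished C t)) := by
  classical
  have key : ∀ U : Finset ι, ∃ y T', ∀ t, 0 ≤ t → unfinished C t = U →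
      D.IsServed U (fun j => R j t) y T' := fun U => by
    by_cases hU : ∃ t, 0 ≤ t ∧ unfinished C t = U
    · obtain ⟨t, ht0, rfl⟩ := hU
      obtain ⟨y, T', hy⟩ : ∃ y T', D.IsServed (unfinished C t) (fun j => R j t) y T' := by
        rcases (unfinished C t).eq_empty_or_nonempty with he | hne
        · refine ⟨0, ∅, fun _ => le_rfl, ⟨Finset.empty_subset _, by simp⟩, ?_, fun P _ => ?_,
            by simp, by simp⟩
          · intro j hj
            have := D.available_subset hj
            simp [he] at this
          · simpa using Finset.sum_nonneg fun j _ => h.isSchedule.rate_nonneg j t ht0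
        · exact (h.rates t ht0 hne).exists_isServed
      refine ⟨y, T', fun s hs0 hst => ?_⟩
      have : (fun j => R j s) = fun j => R j t := by
        ext j
        rcases le_total s t with hle | hle
        · exact h.const s t hs0 hle hst j
        · exact (h.const t s ht0 hle hst.symm j).symm
      rwa [this]
    · exact ⟨0, ∅, fun t ht0 ht => absurd ⟨t, ht0, ht⟩ hU⟩
  choose Y T hYT using key
  exact ⟨Y, T, fun t ht => hYT _ t ht rfl⟩

open Classical in
lemma integral_mem_unfinished (hC : ∀ j, 0 ≤ C j) (j : ι) (hM : C j ≤ M) :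
    ∫ t in (0 : ℝ)..M, (if j ∈ unfinished C t then (1 : ℝ) else 0) = C j := by
  have hi := fun a b => intervalIntegrable_unfinished C (fun U => if j ∈ U then (1 : ℝ) else 0) a b
  rw [← intervalIntegral.integral_add_adjacent_intervals (hi 0 (C j)) (hi (C j) M),
    intervalIntegral.integral_congr_Ioo_of_le (g := fun _ => 1) (hC j)
      fun t ht => if_pos (mem_unfinished.2 ht.2),
    intervalIntegral.integral_congr (a := C j) (b := M) (g := fun _ => 0)]
  · simp
  · intro t ht
    rw [Set.uIcc_of_le hM] at ht
    exact if_neg fun h => not_lt.2 ht.1 (mem_unfinished.1 h)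

open Classical in
/-- The time that a job spends outside of `T` while it is unfinished is at most the length of a
chain of jobs that ends with it. -/
lemma integral_notMem_le {R' : ι → ℝ → ℝ} {C' : ι → ℝ} (hp : ∀ j, 0 ≤ p j)
    (h : D.IsSchedule p R C) (h' : D.IsSchedule p R' C')
    (hYT : ∀ t, 0 ≤ t →
      D.IsServed (unfinished C t) (fun j => R j t) (Y (unfinished C t)) (T (unfinished C t)))
    (hM0 : 0 ≤ M) (hM : ∀ j, C j ≤ M) (k : ι) :
    ∫ t in (0 : ℝ)..M,
      (if k ∈ unfinished C t ∧ k ∉ T (unfinished C t) then (1 : ℝ) else 0) ≤ C' k := by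
  have hi := fun j a b => intervalIntegrable_unfinished C
    (fun U => if j ∈ U ∧ j ∉ T U then (1 : ℝ) else 0) a b
  have hR : ∀ k, ∫ t in (0 : ℝ)..M, R k t ≤ p k := fun k => by
    rw [h.integral_eq k (hM k)]
    exact h.elapsed_completion_le (hp k)
  have hone : ∀ k t, 0 ≤ t → (∀ i, D.prec i k → C i ≤ t) →
      (if k ∈ unfinished C t ∧ k ∉ T (unfinished C t) then (1 : ℝ) else 0) ≤ R k t := by
    intro k t ht hpred
    split_ifs with hk
    · exact ((hYT t ht).rate_eq_one k (D.mem_available.2 ⟨hk.1, fun i hi hiU =>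
        not_lt.2 (hpred i hi) (mem_unfinished.1 hiU)⟩) hk.2).ge
    · exact h.rate_nonneg k t ht
  induction k using D.wellFounded_prec.induction with
  | _ k ih =>
  by_cases hk : ∃ j, D.prec j k
  -- The chain continues with the predecessor `j` completed last. Before `C j`, if `k` is outside
  -- `T`, so is `j`; afterwards `k` is available as long as it is unfinished and runs at rate 1
  -- outside `T`.
  · obtain ⟨j, hj, hmax⟩ := (Finset.univ.filter fun j => D.prec j k).exists_max_image C
      (by simpa [Finset.filter_nonempty_iff] using hk)
    simp only [Finset.mem_filter, Finset.mem_univ, true_and] at hj hmax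
    calc _ ≤ ∫ t in (0 : ℝ)..M,
          ((if j ∈ unfinished C t ∧ j ∉ T (unfinished C t) then (1 : ℝ) else 0) + R k t) := by
          refine intervalIntegral.integral_mono_on hM0 (hi k 0 M)
            ((hi j 0 M).add (h.integrable k M hM0)) fun t ht => ?_
          rcases le_or_gt (C j) t with hjt | hjt
          · refine (hone k t ht.1 fun i hi => (hmax i hi).trans hjt).trans ?_
            have : (0 : ℝ) ≤ if j ∈ unfinished C t ∧ j ∉ T (unfinished C t) then 1 else 0 := by
              positivity
            linarith
          · have hRk := h.rate_nonneg k t ht.1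
            have hjU := mem_unfinished.2 hjt
            by_cases hjT : j ∈ T (unfinished C t)
            · have : ¬ (k ∈ unfinished C t ∧ k ∉ T (unfinished C t)) := fun hk =>
                hk.2 ((hYT t ht.1).closedIn.2 j k hj hjT hk.1)
              rw [if_neg this]
              positivity
            · rw [if_pos (⟨hjU, hjT⟩ : j ∈ unfinished C t ∧ j ∉ T (unfinished C t))]
              split_ifs <;> linarith
      _ ≤ C' j + p k := by
          rw [intervalIntegral.integral_add (hi j 0 M) (h.integrable k M hM0)]
          exact add_le_add (ih j hj) (hR k)
      _ ≤ C' k := h'.add_processing_le hj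
  · push Not at hk
    calc _ ≤ ∫ t in (0 : ℝ)..M, R k t :=
          intervalIntegral.integral_mono_on hM0 (hi k 0 M) (h.integrable k M hM0)
            fun t ht => hone k t ht.1 fun i hi => absurd hi (hk i)
      _ ≤ C' k := (hR k).trans (h'.processing_le k)

/-- The total weight of `T`, integrated over time, is at most twice the cost of any schedule. -/
lemma integral_weight_le {R' : ι → ℝ → ℝ} {C' : ι → ℝ} (hp : ∀ j, 0 ≤ p j)
    (h : D.IsSchedule p R C) (h' : D.IsSchedule p R' C')
    (hYT : ∀ t, 0 ≤ t →
      D.IsServed (unfinished C t) (fun j => R j t) (Y (unfinished C t)) (T (unfinished C t)))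
    (hM0 : 0 ≤ M) (hM : ∀ j, C j ≤ M) :
    ∫ t in (0 : ℝ)..M, ∑ k ∈ T (unfinished C t), D.w k ≤ 2 * D.cost C' := by
  classical
  have hi : ∀ g : Finset ι → ℝ,
      IntervalIntegrable (fun t => g (unfinished C t)) volume 0 M := fun g =>
    intervalIntegrable_unfinished C g 0 M
  let q : ι → ℝ := fun k => ∫ t in (0 : ℝ)..M, Y (unfinished C t) k
  have hq : ∀ k, 0 ≤ q k := fun k =>
    intervalIntegral.integral_nonneg hM0 fun t ht => (hYT t ht.1).nonneg k
  have hsum : ∀ P : Finset ι, (∀ j k, D.prec j k → k ∈ P → j ∈ P) →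
      ∑ k ∈ P, q k ≤ ∑ k ∈ P, p k := fun P hP => by
    calc ∑ k ∈ P, q k = ∫ t in (0 : ℝ)..M, ∑ k ∈ P, Y (unfinished C t) k :=
          (intervalIntegral.integral_finsetSum fun k _ => hi fun U => Y U k).symm
      _ ≤ ∫ t in (0 : ℝ)..M, ∑ k ∈ P, R k t := by
          refine intervalIntegral.integral_mono_on hM0 (hi fun U => ∑ k ∈ P, Y U k)
            (h.intervalIntegrable_sum P hM0) fun t ht => ?_
          exact ((hYT t ht.1).sum_le P hP).trans (Finset.sum_le_sum_of_subset_of_nonneg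
            (Finset.filter_subset _ _) fun j _ _ => h.rate_nonneg j t ht.1)
      _ = ∑ k ∈ P, ∫ t in (0 : ℝ)..M, R k t :=
          intervalIntegral.integral_finsetSum fun k _ => h.integrable k M hM0
      _ ≤ ∑ k ∈ P, p k := Finset.sum_le_sum fun k _ => by
          rw [h.integral_eq k (hM k)]
          exact h.elapsed_completion_le (hp k)
  -- The jobs that `C'` completes by a given time form a predecessor-closed set, so `hsum` transfers
  -- the machine capacity bound from `p` to `q`.
  have hdelay : ∑ k, ∑ l, min (D.w k * q l) (D.w l * q k) ≤ 2 * (D.m * ∑ k, D.w k * C' k) := by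
    refine sum_min_le D.w_nonneg hq fun k => ?_
    refine (hsum _ fun i j hij hj => ?_).trans
      (h'.sum_processing_le (h'.completion_nonneg k) _ fun j hj => by simpa using hj)
    simp only [Finset.mem_filter, Finset.mem_univ, true_and] at hj ⊢
    exact (h'.completion_le_of_prec hij).trans hj
  let g : Finset ι → ι → ι → ℝ := fun U k l => min (D.w k * Y U l) (D.w l * Y U k)
  have hmin : ∀ k l, ∫ t in (0 : ℝ)..M, g (unfinished C t) k l ≤
      min (D.w k * q l) (D.w l * q k) := fun k l => by
    refine le_min ?_ ?_
    · rw [← intervalIntegral.integral_const_mul]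
      exact intervalIntegral.integral_mono_on hM0 (hi fun U => g U k l)
        (hi fun U => D.w k * Y U l) fun t _ => min_le_left _ _
    · rw [← intervalIntegral.integral_const_mul]
      exact intervalIntegral.integral_mono_on hM0 (hi fun U => g U k l)
        (hi fun U => D.w l * Y U k) fun t _ => min_le_right _ _
  -- For `k ∈ T` the minimum is `w k * y l`, by `weight_mul_le`.
  have hpoint : ∀ t, 0 ≤ t → (∑ k ∈ T (unfinished C t), D.w k) * D.m ≤
      ∑ k, ∑ l, g (unfinished C t) k l := fun t ht => by
    have hs := hYT t ht
    refine hs.weight_le.trans ?_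
    rw [Finset.sum_mul]
    calc _ ≤ ∑ k ∈ T (unfinished C t), ∑ l, g (unfinished C t) k l := by
          refine Finset.sum_le_sum fun k hk => ?_
          rw [Finset.mul_sum]
          exact Finset.sum_le_sum fun l _ => le_min le_rfl (hs.weight_mul_le k hk l)
      _ ≤ _ := Finset.sum_le_univ_sum_of_nonneg fun k => Finset.sum_nonneg fun l _ =>
          le_min (mul_nonneg (D.w_nonneg k) (hs.nonneg l)) (mul_nonneg (D.w_nonneg l) (hs.nonneg k))
  have hm0 : (0 : ℝ) < D.m := by exact_mod_cast D.m_pos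
  have hfinal : (∫ t in (0 : ℝ)..M, ∑ k ∈ T (unfinished C t), D.w k) * D.m ≤
      2 * (D.m * ∑ k, D.w k * C' k) := by
    calc _ = ∫ t in (0 : ℝ)..M, (∑ k ∈ T (unfinished C t), D.w k) * D.m :=
          (intervalIntegral.integral_mul_const _ _).symm
      _ ≤ ∫ t in (0 : ℝ)..M, ∑ k, ∑ l, g (unfinished C t) k l :=
          intervalIntegral.integral_mono_on hM0 (hi fun U => (∑ k ∈ T U, D.w k) * D.m)
            (hi fun U => ∑ k, ∑ l, g U k l) fun t ht => hpoint t ht.1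
      _ = ∑ k, ∑ l, ∫ t in (0 : ℝ)..M, g (unfinished C t) k l := by
          rw [intervalIntegral.integral_finsetSum fun k _ => hi fun U => ∑ l, g U k l]
          exact Finset.sum_congr rfl fun k _ =>
            intervalIntegral.integral_finsetSum fun l _ => hi fun U => g U k l
      _ ≤ _ := (Finset.sum_le_sum fun k _ => Finset.sum_le_sum fun l _ => hmin k l).trans hdelay
  unfold cost
  refine le_of_mul_le_mul_right (hfinal.trans_eq ?_) hm0
  ring

theorem IsRun.cost_le {R' : ι → ℝ → ℝ} {C' : ι → ℝ} (hp : ∀ j, 0 ≤ p j) (h : D.IsRun p R C)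
    (h' : D.IsSchedule p R' C') : D.cost C ≤ 3 * D.cost C' := by
  classical
  obtain ⟨Y, T, hYT⟩ := h.exists_isServed
  have hs := h.isSchedule
  have hC := hs.completion_nonneg
  obtain ⟨M, hM0, hM⟩ : ∃ M, 0 ≤ M ∧ ∀ j, C j ≤ M :=
    ⟨∑ j, C j, Finset.sum_nonneg fun j _ => hC j,
      fun j => Finset.single_le_sum (fun j _ => hC j) (Finset.mem_univ j)⟩
  have hi : ∀ g : Finset ι → ℝ,
      IntervalIntegrable (fun t => g (unfinished C t)) volume 0 M := fun g =>
    intervalIntegrable_unfinished C g 0 M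
  -- Each `C k` is the time during which `k` is unfinished, split according to membership in `T`.
  have hsplit : D.cost C = ∑ k, D.w k * (∫ t in (0 : ℝ)..M,
      (if k ∈ unfinished C t ∧ k ∉ T (unfinished C t) then (1 : ℝ) else 0)) +
      ∫ t in (0 : ℝ)..M, ∑ k ∈ T (unfinished C t), D.w k := by
    have h1 : ∀ t, ∑ k ∈ T (unfinished C t), D.w k =
        ∑ k, D.w k * if k ∈ T (unfinished C t) then (1 : ℝ) else 0 := fun t => by simp
    simp only [h1]
    rw [intervalIntegral.integral_finsetSum fun k _ => hi fun U => D.w k * if k ∈ T U then 1 else 0,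
      ← Finset.sum_add_distrib]
    refine Finset.sum_congr rfl fun k _ => ?_
    rw [intervalIntegral.integral_const_mul, ← mul_add, ← intervalIntegral.integral_add
      (hi fun U => if k ∈ U ∧ k ∉ T U then 1 else 0) (hi fun U => if k ∈ T U then 1 else 0)]
    rw [← integral_mem_unfinished hC k (hM k)]
    congr 1
    refine intervalIntegral.integral_congr fun t ht => ?_
    rw [Set.uIcc_of_le hM0] at ht
    have hsub : k ∈ T (unfinished C t) → k ∈ unfinished C t := fun h => (hYT t ht.1).closedIn.1 h
    by_cases h2 : k ∈ T (unfinished C t)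
    · simp [h2, hsub h2]
    · simp [h2]
  have h1 : ∑ k, D.w k * (∫ t in (0 : ℝ)..M,
      (if k ∈ unfinished C t ∧ k ∉ T (unfinished C t) then (1 : ℝ) else 0)) ≤ D.cost C' :=
    Finset.sum_le_sum fun k _ => mul_le_mul_of_nonneg_left
      (integral_notMem_le hp hs h' hYT hM0 hM k) (D.w_nonneg k)
  have h2 := integral_weight_le hp hs h' hYT hM0 hM
  linarith

end KnownData

end PrecSched

end

theorem theorem2 {ι : Type*} [Fintype ι] (D : PrecSched.KnownData ι) :
    -- for positive weights the rate computation is well-defined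
    ((∀ j, 0 < D.w j) → ∀ U : Finset ι, ∃ r : ι → ℝ, D.IsRateChoice U r) ∧
    -- every way of choosing the rates, without knowing `p`, yields a complete schedule
    (∀ σ : Finset ι → ι → ℝ,
      (∀ U : Finset ι, U.Nonempty → D.SuccClosed U → D.IsRateChoice U (σ U)) →
      ∀ p : ι → ℝ, (∀ j, 0 ≤ p j) → ∃ (R : ι → ℝ → ℝ) (C : ι → ℝ), D.IsRun p R C ∧
        ∀ t, 0 ≤ t → ∀ j ∈ D.available (PrecSched.unfinished C t),
          R j t = σ (PrecSched.unfinished C t) j) ∧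
    -- every schedule that the algorithm can produce costs at most three times the optimum
    (∀ p : ι → ℝ, (∀ j, 0 ≤ p j) → ∀ (R : ι → ℝ → ℝ) (C : ι → ℝ), D.IsRun p R C →
      ∀ (R' : ι → ℝ → ℝ) (C' : ι → ℝ), D.IsSchedule p R' C' →
        D.cost C ≤ 3 * D.cost C') := by
  refine ⟨fun hw U => PrecSched.KnownData.exists_isRateChoice D hw U,
    fun σ hσ p hp => PrecSched.KnownData.exists_isRun hσ hp,
    fun p hp R C h R' C' h' => h.cost_le hp h'⟩
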